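/- Let $(\tilde M,\varphi,\xi,\eta,g)$ be a Sasakian manifold, i.e. a normal contact metric manifold: an almost contact metric manifold ($\varphi^2=-I+\eta\otimes\xi$, $\eta(\xi)=1$, $g(\varphi X,\varphi Y)=g(X,Y)-\eta(X)\eta(Y)$) with $d\eta(X,Y)=g(X,\varphi Y)$ and $[\varphi,\varphi]+2\,d\eta\otimes\xi=0$, where $2\,d\eta(X,Y)=X\eta(Y)-Y\eta(X)-\eta([X,Y])$. Let $M=M_T\times_f M_\theta$, with $\dim M_\theta>0$, be a warped product pointwise semi-slant submanifold of $\tilde M$ with $\xi$ tangent to $M_T$. That is: $M_T$ and $M_\theta$ are Riemannian manifolds with metrics $g_T$ and $g_\theta$, $f$ is a positive smooth function on $M_T$, and the product manifold $M=M_T\times M_\theta$ with the metric $g_T+f^2g_\theta$ is isometrically immersed in $\tilde M$; each leaf $M_T\times\{q\}$ is an invariant submanifold ($\varphi$ preserves its tangent spaces) to which $\xi$ is tangent; and each fibre $\{p\}\times M_\theta$ is a pointwise slant submanifold with slant function $\theta(p,\cdot)$, where $\theta:M\to\mathbb R$: for every tangent vector $Z$ of the fibre at $(p,q)$ that is not proportional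 to $\xi$, the angle between $\varphi Z$ and the tangent space of the fibre is $\theta(p,q)$. Then one of the following holds. 1. $M$ is a contact CR-warped product $M_T\times_f M_\perp$: the fibres $\{p\}\times M_\theta$ are anti-invariant ($\varphi$ maps their tangent spaces into their normal spaces), and $\theta=\frac{\pi}{2}$ on $M$. 2. On all of $M$, $\theta$ is differentiable with $\cos\theta\neq 0$, $X(\ln f)=\tan\theta\,X(\theta)$ for every $X$ tangent to $M_T$, and $\nabla(\ln f)=\tan\theta\,\nabla\theta$, where $\nabla$ denotes the gradient on $M$. -/

import Mathlib

open scoped Manifold ContDiff Bundle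

noncomputable section

/-- A smooth Riemannian metric on the manifold `M`. -/
abbrev SmoothMetric {E H : Type*} [NormedAddCommGroup E] [NormedSpace ℝ E] [TopologicalSpace H]
    (I : ModelWithCorners ℝ E H) (M : Type*) [TopologicalSpace M] [ChartedSpace H M]
    [IsManifold I ∞ M] :=
  Bundle.ContMDiffRiemannianMetric I ∞ E (fun x : M => TangentSpace I x)

section AlmostContact

variable {E H : Type*} [NormedAddCommGroup E] [NormedSpace ℝ E] [TopologicalSpace H]
  (I : ModelWithCorners ℝ E H) (N : Type*) [TopologicalSpace N] [ChartedSpace H N]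
  [IsManifold I ∞ N]

/-- An almost contact metric structure `(φ, ξ, η, g)` on the manifold `N`. -/
structure AlmostContactMetric where
  /-- the `(1,1)` tensor field -/
  φ : ∀ x : N, TangentSpace I x →L[ℝ] TangentSpace I x
  /-- the characteristic (Reeb) vector field -/
  ξ : ∀ x : N, TangentSpace I x
  /-- the 1-form -/
  η : ∀ x : N, TangentSpace I x →L[ℝ] ℝ
  /-- the compatible Riemannian metric -/
  g : SmoothMetric I N
  smooth_φ : ContMDiff I (I.prod 𝓘(ℝ, E →L[ℝ] E)) ∞
    (fun x => Bundle.TotalSpace.mk' (E →L[ℝ] E)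
      (E := fun x : N => TangentSpace I x →L[ℝ] TangentSpace I x) x (φ x))
  smooth_ξ : ContMDiff I (I.prod 𝓘(ℝ, E)) ∞
    (fun x => Bundle.TotalSpace.mk' E (E := fun x : N => TangentSpace I x) x (ξ x))
  smooth_η : ContMDiff I (I.prod 𝓘(ℝ, E →L[ℝ] ℝ)) ∞
    (fun x => Bundle.TotalSpace.mk' (E →L[ℝ] ℝ)
      (E := fun x : N => TangentSpace I x →L[ℝ] Bundle.Trivial N ℝ x) x (η x))
  /-- `φ² = -I + η ⊗ ξ` -/
  φ_sq : ∀ (x : N) (v : TangentSpace I x), φ x (φ x v) = -v + η x v • ξ x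
  /-- `η(ξ) = 1` -/
  η_ξ : ∀ x : N, η x (ξ x) = 1
  /-- `η ∘ φ = 0` -/
  η_φ : ∀ (x : N) (v : TangentSpace I x), η x (φ x v) = 0
  /-- `g(φX, φY) = g(X, Y) - η(X) η(Y)` -/
  compat : ∀ (x : N) (v w : TangentSpace I x),
    g.inner x (φ x v) (φ x w) = g.inner x v w - η x v * η x w

variable {I N}

/-- The vector field `X`, seen as a section of the tangent bundle, is smooth at `x`. -/
def SmoothFieldAt (X : ∀ y : N, TangentSpace I y) (x : N) : Prop :=
  ContMDiffAt I (I.prod 𝓘(ℝ, E)) ∞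
    (fun y => Bundle.TotalSpace.mk' E (E := fun y : N => TangentSpace I y) y (X y)) x

namespace AlmostContactMetric

/-- The exterior derivative of `η`, evaluated on two vector fields:
`dη(X, Y) = (X(η(Y)) - Y(η(X)) - η([X, Y])) / 2`. -/
def dη (S : AlmostContactMetric I N) (X Y : ∀ y : N, TangentSpace I y) (x : N) : ℝ :=
  (mvfderiv I (fun y => S.η y (Y y)) x (X x) - mvfderiv I (fun y => S.η y (X y)) x (Y x)
    - S.η x (VectorField.mlieBracket I X Y x)) / 2

/-- The Nijenhuis torsion of `φ`, evaluated on two vector fields: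
`[φ, φ](X, Y) = φ²[X, Y] + [φX, φY] - φ[φX, Y] - φ[X, φY]`. -/
def nijenhuis (S : AlmostContactMetric I N) (X Y : ∀ y : N, TangentSpace I y) (x : N) :
    TangentSpace I x :=
  S.φ x (S.φ x (VectorField.mlieBracket I X Y x))
    + VectorField.mlieBracket I (fun y => S.φ y (X y)) (fun y => S.φ y (Y y)) x
    - S.φ x (VectorField.mlieBracket I (fun y => S.φ y (X y)) Y x)
    - S.φ x (VectorField.mlieBracket I X (fun y => S.φ y (Y y)) x)

/-- A Sasakian structure is a normal contact metric structure. -/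
structure IsSasakian (S : AlmostContactMetric I N) : Prop where
  /-- contact metric: `dη(X, Y) = g(X, φY)` -/
  contact : ∀ (x : N) (X Y : ∀ y : N, TangentSpace I y), SmoothFieldAt X x → SmoothFieldAt Y x →
    S.dη X Y x = S.g.inner x (X x) (S.φ x (Y x))
  /-- normal: `[φ, φ] + 2 dη ⊗ ξ = 0` -/
  normal : ∀ (x : N) (X Y : ∀ y : N, TangentSpace I y), SmoothFieldAt X x → SmoothFieldAt Y x →
    S.nijenhuis X Y x + (2 * S.dη X Y x) • S.ξ x = 0

end AlmostContactMetric

/-- The angle (in `[0, π]`) between two nonzero tangent vectors. -/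
def SmoothMetric.angle (g : SmoothMetric I N) (x : N) (u w : TangentSpace I x) : ℝ :=
  Real.arccos (g.inner x u w / (√(g.inner x u u) * √(g.inner x w w)))

/-- The angle between a nonzero tangent vector `u` and a nonzero subspace `W` of the tangent space:
the smallest angle between `u` and a nonzero vector of `W`. -/
def SmoothMetric.angleSubspace (g : SmoothMetric I N) (x : N) (u : TangentSpace I x)
    (W : Submodule ℝ (TangentSpace I x)) : ℝ :=
  sInf {a : ℝ | ∃ w ∈ W, w ≠ 0 ∧ a = SmoothMetric.angle g x u w}

end AlmostContact

section Immersed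

variable {E H : Type*} [NormedAddCommGroup E] [NormedSpace ℝ E] [TopologicalSpace H]
  {I : ModelWithCorners ℝ E H} {N : Type*} [TopologicalSpace N] [ChartedSpace H N]
  [IsManifold I ∞ N]
  {E' H' : Type*} [NormedAddCommGroup E'] [NormedSpace ℝ E'] [TopologicalSpace H']
  (I' : ModelWithCorners ℝ E' H') {L : Type*} [TopologicalSpace L] [ChartedSpace H' L]

/-- The tangent space at `p` of the submanifold of `N` given by the immersion `j : L → N`, as a
subspace of the tangent space of `N` at `j p`. -/
def tangentRange (I : ModelWithCorners ℝ E H) (j : L → N) (p : L) :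
    Submodule ℝ (TangentSpace I (j p)) :=
  LinearMap.range (mfderiv I' I j p).toLinearMap

/-- The immersed submanifold `j : L → N` is invariant: `φ` maps its tangent spaces to
themselves. -/
def IsInvariantSubmanifold (S : AlmostContactMetric I N) (j : L → N) : Prop :=
  ∀ (p : L), ∀ u ∈ tangentRange I' I j p, S.φ (j p) u ∈ tangentRange I' I j p

/-- The immersed submanifold `j : L → N` is anti-invariant: `φ` maps its tangent spaces into its
normal spaces. -/
def IsAntiInvariantSubmanifold (S : AlmostContactMetric I N) (j : L → N) : Prop :=
  ∀ (p : L), ∀ u ∈ tangentRange I' I j p, ∀ w ∈ tangentRange I' I j p,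
    S.g.inner (j p) (S.φ (j p) u) w = 0

/-- The immersed submanifold `j : L → N` is pointwise slant with slant function `θ`: for every
tangent vector `u` at `p` that is not proportional to `ξ`, the angle between `φ u` and the tangent
space of the submanifold at `p` is `θ p`. -/
def IsPointwiseSlant (S : AlmostContactMetric I N) (j : L → N) (θ : L → ℝ) : Prop :=
  ∀ (p : L), ∀ u ∈ tangentRange I' I j p, u ∉ Submodule.span ℝ {S.ξ (j p)} →
    SmoothMetric.angleSubspace S.g (j p) (S.φ (j p) u) (tangentRange I' I j p) = θ p

end Immersed

section Gradient

variable {E H : Type*} [NormedAddCommGroup E] [NormedSpace ℝ E]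
  [TopologicalSpace H] {I : ModelWithCorners ℝ E H} {M : Type*} [TopologicalSpace M]
  [ChartedSpace H M] [IsManifold I ∞ M]

/-- The linear map `v ↦ g(v, ·)` from a tangent space to its dual. -/
def SmoothMetric.flat (g : SmoothMetric I M) (x : M) : E →ₗ[ℝ] Module.Dual ℝ E where
  toFun v := (g.inner x v : E →L[ℝ] ℝ).toLinearMap
  map_add' v w := by
    apply LinearMap.ext
    intro u
    have h : g.inner x (v + w : TangentSpace I x) = g.inner x v + g.inner x w := map_add _ _ _
    exact congrArg (fun k : TangentSpace I x →L[ℝ] ℝ => k u) h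
  map_smul' c v := by
    apply LinearMap.ext
    intro u
    have h : g.inner x (c • v : TangentSpace I x) = c • g.inner x v := map_smul _ _ _
    exact congrArg (fun k : TangentSpace I x →L[ℝ] ℝ => k u) h

theorem SmoothMetric.flat_injective (g : SmoothMetric I M) (x : M) :
    Function.Injective (SmoothMetric.flat g x) := by
  rw [injective_iff_map_eq_zero]
  intro v hv
  by_contra hne
  have h0 : g.inner x v v = 0 := congrArg (fun k : Module.Dual ℝ E => k v) hv
  exact absurd h0 (g.pos x v hne).ne'

/-- The gradient at `x` of a real function `h`: the tangent vector `v` with `g(v, w) = dh(w)` for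
all `w`. -/
def SmoothMetric.grad [FiniteDimensional ℝ E] (g : SmoothMetric I M) (h : M → ℝ) (x : M) :
    TangentSpace I x :=
  (LinearMap.linearEquivOfInjective (SmoothMetric.flat g x) (SmoothMetric.flat_injective g x)
    Subspace.dual_finrank_eq.symm).symm (mvfderiv I h x : E →L[ℝ] ℝ).toLinearMap

theorem SmoothMetric.inner_grad [FiniteDimensional ℝ E] (g : SmoothMetric I M) (h : M → ℝ)
    (x : M) (w : TangentSpace I x) :
    g.inner x (SmoothMetric.grad g h x) w = mvfderiv I h x w := by
  have key := LinearEquiv.apply_symm_apply (LinearMap.linearEquivOfInjective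
    (SmoothMetric.flat g x) (SmoothMetric.flat_injective g x)
    Subspace.dual_finrank_eq.symm) (mvfderiv I h x : E →L[ℝ] ℝ).toLinearMap
  exact congrArg (fun k : Module.Dual ℝ E => k w) key

end Gradient

section Warped

variable {E H : Type*} [NormedAddCommGroup E] [NormedSpace ℝ E] [TopologicalSpace H]
  {I : ModelWithCorners ℝ E H} {N : Type*} [TopologicalSpace N] [ChartedSpace H N]
  [IsManifold I ∞ N]
  {E₁ H₁ : Type*} [NormedAddCommGroup E₁] [NormedSpace ℝ E₁] [TopologicalSpace H₁]
  {I₁ : ModelWithCorners ℝ E₁ H₁} {M₁ : Type*} [TopologicalSpace M₁] [ChartedSpace H₁ M₁]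
  [IsManifold I₁ ∞ M₁]
  {E₂ H₂ : Type*} [NormedAddCommGroup E₂] [NormedSpace ℝ E₂] [TopologicalSpace H₂]
  {I₂ : ModelWithCorners ℝ E₂ H₂} {M₂ : Type*} [TopologicalSpace M₂] [ChartedSpace H₂ M₂]
  [IsManifold I₂ ∞ M₂]

/-- `g` is the metric of the warped product `M₁ ×_f M₂`:
`g(X, Y) = g₁(π₁⋆X, π₁⋆Y) + (f ∘ π₁)² g₂(π₂⋆X, π₂⋆Y)` with `f` smooth and positive on `M₁`. -/
structure IsWarpedProductMetric (g₁ : SmoothMetric I₁ M₁) (g₂ : SmoothMetric I₂ M₂)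
    (f : M₁ → ℝ) (g : SmoothMetric (I₁.prod I₂) (M₁ × M₂)) : Prop where
  smooth_f : ContMDiff I₁ 𝓘(ℝ, ℝ) ∞ f
  pos_f : ∀ p, 0 < f p
  inner_eq : ∀ (x : M₁ × M₂) (v w : TangentSpace (I₁.prod I₂) x),
    g.inner x v w =
      g₁.inner x.1 (mfderiv (I₁.prod I₂) I₁ Prod.fst x v) (mfderiv (I₁.prod I₂) I₁ Prod.fst x w)
      + f x.1 ^ 2 *
        g₂.inner x.2 (mfderiv (I₁.prod I₂) I₂ Prod.snd x v)
          (mfderiv (I₁.prod I₂) I₂ Prod.snd x w)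

/-- `ι` is an isometric immersion. -/
structure IsIsometricImmersion {E' H' : Type*} [NormedAddCommGroup E'] [NormedSpace ℝ E']
    [TopologicalSpace H'] {I' : ModelWithCorners ℝ E' H'} {L : Type*} [TopologicalSpace L]
    [ChartedSpace H' L] [IsManifold I' ∞ L]
    (gL : SmoothMetric I' L) (gN : SmoothMetric I N) (ι : L → N) : Prop where
  smooth : ContMDiff I' I ∞ ι
  isometric : ∀ (x : L) (v w : TangentSpace I' x),
    gN.inner (ι x) (mfderiv I' I ι x v) (mfderiv I' I ι x w) = gL.inner x v w

/-- `ι` makes the warped product `M₁ ×_f M₂` a warped product submanifold of `N` whose leaves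
`M₁ × {q}` are invariant submanifolds to which `ξ` is tangent. -/
structure IsWarpedInvariantBase (S : AlmostContactMetric I N)
    (g₁ : SmoothMetric I₁ M₁) (g₂ : SmoothMetric I₂ M₂) (f : M₁ → ℝ)
    (g : SmoothMetric (I₁.prod I₂) (M₁ × M₂)) (ι : M₁ × M₂ → N) : Prop where
  warped : IsWarpedProductMetric g₁ g₂ f g
  immersion : IsIsometricImmersion g S.g ι
  invariant : ∀ q : M₂, IsInvariantSubmanifold I₁ S (fun p : M₁ => ι (p, q))
  ξ_tangent : ∀ (p : M₁) (q : M₂), S.ξ (ι (p, q)) ∈ tangentRange I₁ I (fun p : M₁ => ι (p, q)) p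

/-- A warped product pointwise semi-slant submanifold `M_T ×_f M_θ` with `ξ` tangent to `M_T`: the
leaves `M_T × {q}` are invariant, and the fibres `{p} × M_θ` are pointwise slant, the slant
function being `θ : M_T × M_θ → ℝ`. -/
structure IsWarpedPointwiseSemiSlant (S : AlmostContactMetric I N)
    (gT : SmoothMetric I₁ M₁) (gθ : SmoothMetric I₂ M₂) (f : M₁ → ℝ)
    (g : SmoothMetric (I₁.prod I₂) (M₁ × M₂)) (ι : M₁ × M₂ → N) (θ : M₁ × M₂ → ℝ) : Prop extends
    IsWarpedInvariantBase S gT gθ f g ι where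
  slant : ∀ p : M₁, IsPointwiseSlant I₂ S (fun q : M₂ => ι (p, q)) (fun q => θ (p, q))

/-- A contact CR-warped product `M_T ×_f M_⊥`: the leaves `M_T × {q}` are invariant and tangent
to `ξ`, and the fibres `{p} × M_⊥` are anti-invariant. -/
structure IsContactCRWarped (S : AlmostContactMetric I N)
    (gT : SmoothMetric I₁ M₁) (gP : SmoothMetric I₂ M₂) (f : M₁ → ℝ)
    (g : SmoothMetric (I₁.prod I₂) (M₁ × M₂)) (ι : M₁ × M₂ → N) : Prop extends
    IsWarpedInvariantBase S gT gP f g ι where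
  antiInvariant : ∀ p : M₁, IsAntiInvariantSubmanifold I₂ S (fun q : M₂ => ι (p, q))

end Warped

end

/-! Leaves and fibres of a warped product are `g`-orthogonal and `ξ` is tangent to the leaves, so
the 1-form `η = g(ξ, ·)` vanishes on the fibres. Its pullback to a fibre is zero, hence so is the
pullback of `dη`, which by the contact condition is `g(·, φ ·)`. The fibres are therefore
anti-invariant, which forces `θ = π / 2`: the first alternative always holds. -/

open scoped Topology

section ExteriorDerivative

variable {𝕜 E E' G : Type*} [NontriviallyNormedField 𝕜] [NormedAddCommGroup E] [NormedSpace 𝕜 E]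
  [NormedAddCommGroup E'] [NormedSpace 𝕜 E'] [NormedAddCommGroup G] [NormedSpace 𝕜 G]
  {α : E → E →L[𝕜] G}

theorem differentiableAt_ofSubsingleton {x : E} (hα : DifferentiableAt 𝕜 α x) :
    DifferentiableAt 𝕜
      (fun y => ContinuousAlternatingMap.ofSubsingleton 𝕜 E G (0 : Fin 1) (α y)) x :=
  (ContinuousAlternatingMap.ofSubsingletonLIE (𝕜 := 𝕜) (E := E) (F := G)
    (0 : Fin 1)).differentiableAt.comp _ hα

theorem extDeriv_ofSubsingleton_apply {x : E} (hα : DifferentiableAt 𝕜 α x) (v : Fin 2 → E) :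
    extDeriv (fun y => ContinuousAlternatingMap.ofSubsingleton 𝕜 E G (0 : Fin 1) (α y)) x v
      = fderiv 𝕜 α x (v 0) (v 1) - fderiv 𝕜 α x (v 1) (v 0) := by
  have happly (c d : E) : fderiv 𝕜 (fun y => α y c) x d = fderiv 𝕜 α x d c := by
    simp [fderiv_clm_apply hα (differentiableAt_const c)]
  simp [extDeriv_apply (differentiableAt_ofSubsingleton hα), Fin.sum_univ_two, happly,
    Fin.removeNth, sub_eq_add_neg]

theorem fderiv_apply_comm_of_pullback_eq_zero {F : E' → E} {x : E'} {r : WithTop ℕ∞}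
    (hF : ContDiffAt 𝕜 r F x) (hr : minSmoothness 𝕜 2 ≤ r) (hα : DifferentiableAt 𝕜 α (F x))
    (h : ∀ᶠ z in 𝓝 x, ∀ u, α (F z) (fderiv 𝕜 F z u) = 0) (u w : E') :
    fderiv 𝕜 α (F x) (fderiv 𝕜 F x u) (fderiv 𝕜 F x w)
      = fderiv 𝕜 α (F x) (fderiv 𝕜 F x w) (fderiv 𝕜 F x u) := by
  let β (y : E) := ContinuousAlternatingMap.ofSubsingleton 𝕜 E G (0 : Fin 1) (α y)
  have hpull : (fun z => (β (F z)).compContinuousLinearMap (fderiv 𝕜 F z)) =ᶠ[𝓝 x]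
      fun _ => 0 := by
    filter_upwards [h] with z hz
    ext v
    exact hz (v 0)
  have hd : (extDeriv β (F x)).compContinuousLinearMap (fderiv 𝕜 F x) = 0 := by
    rw [← extDeriv_pullback (differentiableAt_ofSubsingleton hα) hF hr, hpull.extDeriv_eq,
      extDeriv, fderiv_fun_const]
    exact (ContinuousAlternatingMap.alternatizeUncurryFinCLM 𝕜 E' G).map_zero
  exact sub_eq_zero.1 ((extDeriv_ofSubsingleton_apply hα _).symm.trans
    (congrArg (fun k => k ![u, w]) hd))

end ExteriorDerivative

section ChartFields

variable {E H : Type*} [NormedAddCommGroup E] [NormedSpace ℝ E] [TopologicalSpace H]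
  {I : ModelWithCorners ℝ E H} {N : Type*} [TopologicalSpace N] [ChartedSpace H N]

/-- The vector field with constant coordinates `a` in the preferred chart at `y`, meaningful on the
domain of that chart. Two such fields commute, so evaluating `dη` on them involves no bracket. -/
noncomputable def chartConstField (I : ModelWithCorners ℝ E H) (y : N) (a : E) (z : N) :
    TangentSpace I z :=
  VectorField.mpullback I 𝓘(ℝ, E) (extChartAt I y) (fun _ => a) z

/-- The coordinate expression, in the preferred chart at `y`, of a 1-form `α`: the pullback of `α`
under the inverse chart, written with the inverse of the derivative of the chart. It is meaningful
on the target of the chart and turns exterior derivatives into Fréchet derivatives. -/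
noncomputable def chartOneForm (α : ∀ x : N, TangentSpace I x →L[ℝ] ℝ) (y : N) (e : E) :
    E →L[ℝ] ℝ :=
  (α ((extChartAt I y).symm e) : E →L[ℝ] ℝ) ∘L
    (mfderiv I 𝓘(ℝ, E) (extChartAt I y) ((extChartAt I y).symm e) : E →L[ℝ] E).inverse

theorem chartOneForm_extChartAt_apply (α : ∀ x : N, TangentSpace I x →L[ℝ] ℝ) {y z : N}
    (hz : z ∈ (extChartAt I y).source) (a : E) :
    chartOneForm α y (extChartAt I y z) a = α z (chartConstField I y a z) := by
  have h : chartOneForm α y (extChartAt I y z) a = α ((extChartAt I y).symm (extChartAt I y z))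
    (chartConstField I y a ((extChartAt I y).symm (extChartAt I y z))) := rfl
  rw [h, (extChartAt I y).left_inv hz]

variable [IsManifold I ∞ N]

theorem mfderiv_extChartAt_chartConstField {y z : N} (hz : z ∈ (extChartAt I y).source) (a : E) :
    mfderiv I 𝓘(ℝ, E) (extChartAt I y) z (chartConstField I y a z) = a :=
  (isInvertible_mfderiv_extChartAt hz).self_apply_inverse a

theorem chartConstField_mfderiv_extChartAt {y z : N} (hz : z ∈ (extChartAt I y).source)
    (v : TangentSpace I z) :
    chartConstField I y (mfderiv I 𝓘(ℝ, E) (extChartAt I y) z v) z = v :=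
  (isInvertible_mfderiv_extChartAt hz).inverse_apply_self v

theorem symmL_trivializationAt_eq_inverse_mfderiv_extChartAt {y z : N}
    (hz : z ∈ (chartAt H y).source) :
    (trivializationAt E (TangentSpace I) y).symmL ℝ z
      = (mfderiv I 𝓘(ℝ, E) (extChartAt I y) z).inverse := by
  have hbase : z ∈ (trivializationAt E (TangentSpace I) y).baseSet := hz
  rw [← TangentBundle.continuousLinearMapAt_trivializationAt hz,
    ← Bundle.Trivialization.coe_continuousLinearEquivAt_eq' _ hbase,
    ← Bundle.Trivialization.symm_continuousLinearEquivAt_eq' _ hbase]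
  exact (ContinuousLinearMap.inverse_equiv _).symm

theorem differentiableAt_chartOneForm [I.Boundaryless]
    {α : ∀ x : N, TangentSpace I x →L[ℝ] ℝ} {y : N}
    (hα : ContMDiffAt I (I.prod 𝓘(ℝ, E →L[ℝ] ℝ)) ∞
      (fun x => Bundle.TotalSpace.mk' (E →L[ℝ] ℝ)
        (E := fun x : N => TangentSpace I x →L[ℝ] Bundle.Trivial N ℝ x) x (α x)) y) :
    DifferentiableAt ℝ (chartOneForm α y) (extChartAt I y y) := by
  have hcoord := ((contMDiffAt_hom_bundle _).1 hα).2
  have hsymm : ContMDiffAt 𝓘(ℝ, E) I ∞ (extChartAt I y).symm (extChartAt I y y) :=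
    (contMDiffOn_extChartAt_symm y).contMDiffAt (extChartAt_target_mem_nhds y)
  have hcomp := (contMDiffAt_iff_contDiffAt.1
    (hcoord.comp_of_eq hsymm (extChartAt_to_inv y))).differentiableAt (by simp)
  refine hcomp.congr_of_eventuallyEq ?_
  filter_upwards [extChartAt_target_mem_nhds (I := I) y] with e he
  have hz : (extChartAt I y).symm e ∈ (chartAt H y).source := by
    simpa only [extChartAt_source] using (extChartAt I y).map_target he
  ext a
  simp only [Function.comp, ContinuousLinearMap.inCoordinates]
  rw [symmL_trivializationAt_eq_inverse_mfderiv_extChartAt hz]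
  simp [chartOneForm]

theorem smoothFieldAt_chartConstField [CompleteSpace E] (y : N) (a : E) :
    SmoothFieldAt (chartConstField I y a) y := by
  have hconst : ContMDiffAt 𝓘(ℝ, E) (𝓘(ℝ, E).prod 𝓘(ℝ, E)) ∞
      (fun z : E => Bundle.TotalSpace.mk' E (E := fun z : E => TangentSpace 𝓘(ℝ, E) z) z a)
      (extChartAt I y y) :=
    contMDiffAt_vectorSpace_iff_contDiffAt.2 contDiffAt_const
  exact hconst.mpullback_vectorField_preimage (n := ∞) contMDiffAt_extChartAt
    (isInvertible_mfderiv_extChartAt (mem_extChartAt_source y)) le_rfl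

theorem mlieBracket_chartConstField [CompleteSpace E] (y : N) (a b : E) :
    VectorField.mlieBracket I (chartConstField I y a) (chartConstField I y b) y = 0 := by
  have hmin (k : ℕ∞) : minSmoothness ℝ k ≤ ∞ := by
    rw [minSmoothness_of_isRCLikeNormedField]
    exact WithTop.coe_le_coe.2 le_top
  have : IsManifold I (minSmoothness ℝ 3) N := .of_le (n := ∞) (hmin 3)
  have hconst (c : E) : MDifferentiableAt 𝓘(ℝ, E) (𝓘(ℝ, E).prod 𝓘(ℝ, E))
      (fun z : E => Bundle.TotalSpace.mk' E (E := fun z : E => TangentSpace 𝓘(ℝ, E) z) z c)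
      (extChartAt I y y) :=
    (contMDiffAt_vectorSpace_iff_contDiffAt.2
      (contDiffAt_const (n := 1))).mdifferentiableAt one_ne_zero
  have hpull := VectorField.mpullback_mlieBracket (I := I) (I' := 𝓘(ℝ, E)) (n := ∞)
    (hconst a) (hconst b) (contMDiffAt_extChartAt (x := y)) (hmin 2)
  have hzero : VectorField.mlieBracket 𝓘(ℝ, E) (fun _ : E => a) (fun _ : E => b) = 0 := by
    refine VectorField.mlieBracketWithin_univ.symm.trans
      (VectorField.mlieBracketWithin_eq_lieBracketWithin.trans ?_)
    ext z
    simp only [VectorField.lieBracketWithin, fderivWithin_fun_const]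
    exact sub_self (0 : E)
  rw [hzero, VectorField.mpullback_zero] at hpull
  exact hpull.symm

theorem mvfderiv_apply_chartConstField {α : ∀ x : N, TangentSpace I x →L[ℝ] ℝ} {y : N}
    (hα : DifferentiableAt ℝ (chartOneForm α y) (extChartAt I y y)) (a : E)
    (v : TangentSpace I y) :
    mvfderiv I (fun z => α z (chartConstField I y a z)) y v
      = fderiv ℝ (chartOneForm α y) (extChartAt I y y)
          (mfderiv I 𝓘(ℝ, E) (extChartAt I y) y v) a := by
  have heq : (fun z => α z (chartConstField I y a z)) =ᶠ[𝓝 y]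
      (fun e => chartOneForm α y e a) ∘ extChartAt I y := by
    filter_upwards [extChartAt_source_mem_nhds (I := I) y] with z hz
    exact (chartOneForm_extChartAt_apply α hz a).symm
  have ha : HasFDerivAt (fun e => chartOneForm α y e a) _ (extChartAt I y y) :=
    (ContinuousLinearMap.apply ℝ ℝ a).hasFDerivAt.comp _ hα.hasFDerivAt
  have hchart : MDifferentiableAt I 𝓘(ℝ, E) (extChartAt I y) y :=
    mdifferentiableAt_extChartAt (mem_chart_source H y)
  have h := (ha.hasMFDerivAt.comp y hchart.hasMFDerivAt).congr_of_eventuallyEq heq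
  exact congrArg (fun k : E →L[ℝ] ℝ => k v) h.mfderiv

theorem fderiv_extChartAt_comp_apply {E' : Type*} [NormedAddCommGroup E'] [NormedSpace ℝ E']
    {σ : E' → N} {x : E'} {y : N} (hσ : MDifferentiableAt 𝓘(ℝ, E') I σ x)
    (hx : σ x ∈ (extChartAt I y).source) (u : E') :
    fderiv ℝ (extChartAt I y ∘ σ) x u
      = mfderiv I 𝓘(ℝ, E) (extChartAt I y) (σ x) (mfderiv 𝓘(ℝ, E') I σ x u) := by
  rw [← mfderiv_eq_fderiv]
  exact mfderiv_comp_apply x (mdifferentiableAt_extChartAt (by simpa using hx)) hσ u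

theorem chartOneForm_apply_fderiv_extChartAt_comp {E' : Type*} [NormedAddCommGroup E']
    [NormedSpace ℝ E'] (α : ∀ x : N, TangentSpace I x →L[ℝ] ℝ) {σ : E' → N} {x : E'} {y : N}
    (hσ : MDifferentiableAt 𝓘(ℝ, E') I σ x) (hx : σ x ∈ (extChartAt I y).source) (u : E') :
    chartOneForm α y (extChartAt I y (σ x)) (fderiv ℝ (extChartAt I y ∘ σ) x u)
      = α (σ x) (mfderiv 𝓘(ℝ, E') I σ x u) := by
  rw [fderiv_extChartAt_comp_apply hσ hx]
  exact (chartOneForm_extChartAt_apply α hx _).trans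
    (congrArg (α (σ x)) (chartConstField_mfderiv_extChartAt hx _))

end ChartFields

namespace AlmostContactMetric

variable {E H : Type*} [NormedAddCommGroup E] [NormedSpace ℝ E] [TopologicalSpace H]
  {I : ModelWithCorners ℝ E H} {N : Type*} [TopologicalSpace N] [ChartedSpace H N]
  [IsManifold I ∞ N] {S : AlmostContactMetric I N}

variable (S) in
/-- The contact metric condition `dη(X, Y) = g(X, φY)`: a Sasakian structure without the
normality of `φ`. -/
def IsContactMetric : Prop :=
  ∀ (x : N) (X Y : ∀ y : N, TangentSpace I y), SmoothFieldAt X x → SmoothFieldAt Y x →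
    S.dη X Y x = S.g.inner x (X x) (S.φ x (Y x))

theorem dη_chartConstField [CompleteSpace E] [I.Boundaryless] (y : N) (a b : E) :
    S.dη (chartConstField I y a) (chartConstField I y b) y
      = (fderiv ℝ (chartOneForm S.η y) (extChartAt I y y) a b
        - fderiv ℝ (chartOneForm S.η y) (extChartAt I y y) b a) / 2 := by
  have hη := differentiableAt_chartOneForm (S.smooth_η.contMDiffAt (x := y))
  rw [dη, mlieBracket_chartConstField, mvfderiv_apply_chartConstField hη,
    mvfderiv_apply_chartConstField hη,
    mfderiv_extChartAt_chartConstField (mem_extChartAt_source y),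
    mfderiv_extChartAt_chartConstField (mem_extChartAt_source y), map_zero, sub_zero]

theorem IsContactMetric.inner_mfderiv_φ_mfderiv_eq_zero [CompleteSpace E] [I.Boundaryless]
    (hS : S.IsContactMetric) {E' : Type*} [NormedAddCommGroup E'] [NormedSpace ℝ E']
    {σ : E' → N} {x : E'} (hσ : ContMDiffAt 𝓘(ℝ, E') I 2 σ x)
    (h : ∀ᶠ z in 𝓝 x, ∀ u : E', S.η (σ z) (mfderiv 𝓘(ℝ, E') I σ z u) = 0) (u w : E') :
    S.g.inner (σ x) (mfderiv 𝓘(ℝ, E') I σ x u) (S.φ (σ x) (mfderiv 𝓘(ℝ, E') I σ x w)) = 0 := by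
  let c := extChartAt I (σ x)
  have hx : σ x ∈ c.source := mem_extChartAt_source (σ x)
  have hF : ContDiffAt ℝ 2 (c ∘ σ) x :=
    (contMDiffAt_extChartAt.comp x hσ).contDiffAt
  have hpull : ∀ᶠ z in 𝓝 x, ∀ v : E',
      chartOneForm S.η (σ x) ((c ∘ σ) z) (fderiv ℝ (c ∘ σ) z v) = 0 := by
    filter_upwards [h, (contMDiffAt_iff_contMDiffAt_nhds (by simp)).1 hσ,
      hσ.continuousAt.eventually (extChartAt_source_mem_nhds (I := I) (σ x))]
      with z hz hσz hzs v
    exact (chartOneForm_apply_fderiv_extChartAt_comp S.η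
      (hσz.mdifferentiableAt (by simp)) hzs v).trans (hz v)
  have hcomm := fderiv_apply_comm_of_pullback_eq_zero hF (by simp)
    (differentiableAt_chartOneForm S.smooth_η.contMDiffAt) hpull u w
  have hfield (v : E') : chartConstField I (σ x) (fderiv ℝ (c ∘ σ) x v) (σ x)
      = mfderiv 𝓘(ℝ, E') I σ x v := by
    rw [fderiv_extChartAt_comp_apply (hσ.mdifferentiableAt (by simp)) hx,
      chartConstField_mfderiv_extChartAt hx]
  rw [← hfield u, ← hfield w, ← hS _ _ _ (smoothFieldAt_chartConstField _ _)
    (smoothFieldAt_chartConstField _ _), dη_chartConstField]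
  exact div_eq_zero_iff.2 (.inl (sub_eq_zero.2 hcomm))

theorem IsContactMetric.isAntiInvariantSubmanifold [CompleteSpace E] [I.Boundaryless]
    (hS : S.IsContactMetric) {E' H' : Type*} [NormedAddCommGroup E'] [NormedSpace ℝ E']
    [TopologicalSpace H'] {I' : ModelWithCorners ℝ E' H'} [I'.Boundaryless] {L : Type*}
    [TopologicalSpace L] [ChartedSpace H' L] [IsManifold I' ∞ L] {j : L → N}
    (hj : ContMDiff I' I ∞ j)
    (h : ∀ q (v : TangentSpace I' q), S.η (j q) (mfderiv I' I j q v) = 0) :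
    IsAntiInvariantSubmanifold I' S j := by
  rintro q _ ⟨v, rfl⟩ _ ⟨w, rfl⟩
  let d := extChartAt I' q
  let σ : E' → N := j ∘ d.symm
  have hσq : σ (d q) = j q := congrArg j (extChartAt_to_inv q)
  have hdsymm {e : E'} (he : e ∈ d.target) : ContMDiffAt 𝓘(ℝ, E') I' ∞ d.symm e :=
    (contMDiffOn_extChartAt_symm q).contMDiffAt ((isOpen_extChartAt_target q).mem_nhds he)
  have hσ : ContMDiffAt 𝓘(ℝ, E') I ∞ σ (d q) := (hj _).comp _ (hdsymm (mem_extChartAt_target q))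
  have hη : ∀ᶠ e in 𝓝 (d q), ∀ u : E', S.η (σ e) (mfderiv 𝓘(ℝ, E') I σ e u) = 0 := by
    filter_upwards [extChartAt_target_mem_nhds (I := I') q] with e he u
    exact (congrArg (S.η (σ e)) (mfderiv_comp_apply e (hj.mdifferentiable (by simp) _)
      ((hdsymm he).mdifferentiableAt (by simp)) u)).trans (h _ _)
  have hround (u : TangentSpace I' q) :
      mfderiv 𝓘(ℝ, E') I σ (d q) (mfderiv I' 𝓘(ℝ, E') d q u) = mfderiv I' I j q u := by
    have heq : σ ∘ d =ᶠ[𝓝 q] j := by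
      filter_upwards [extChartAt_source_mem_nhds (I := I') q] with z hz
      exact congrArg j (d.left_inv hz)
    have hdq : MDifferentiableAt I' 𝓘(ℝ, E') d q :=
      mdifferentiableAt_extChartAt (mem_chart_source H' q)
    exact (mfderiv_comp_apply q (hσ.mdifferentiableAt (by simp)) hdq u).symm.trans
      (congrArg (fun k : E' →L[ℝ] E => k u) heq.mfderiv_eq)
  have key := hS.inner_mfderiv_φ_mfderiv_eq_zero (hσ.of_le ENat.LEInfty.out) hη
    (mfderiv I' 𝓘(ℝ, E') d q w) (mfderiv I' 𝓘(ℝ, E') d q v)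
  rw [hround, hround, hσq] at key
  exact (S.g.symm _ _ _).trans key

theorem φ_ξ (S : AlmostContactMetric I N) (x : N) : S.φ x (S.ξ x) = 0 := by
  have hsq : S.φ x (S.φ x (S.ξ x)) = 0 := by rw [S.φ_sq, S.η_ξ, one_smul, neg_add_cancel]
  have hnorm := S.compat x (S.φ x (S.ξ x)) (S.φ x (S.ξ x))
  rw [hsq, map_zero, S.η_φ, mul_zero, sub_zero] at hnorm
  by_contra hne
  exact (S.g.pos x _ hne).ne hnorm

theorem η_eq_inner_ξ (S : AlmostContactMetric I N) (x : N) (v : TangentSpace I x) :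
    S.η x v = S.g.inner x (S.ξ x) v := by
  have h := S.compat x (S.ξ x) v
  rw [φ_ξ, map_zero, S.η_ξ, one_mul] at h
  exact (sub_eq_zero.1 h.symm).symm

theorem notMem_span_ξ {x : N} {u : TangentSpace I x} (hη : S.η x u = 0) (hu : u ≠ 0) :
    u ∉ Submodule.span ℝ {S.ξ x} := by
  rw [Submodule.mem_span_singleton]
  rintro ⟨c, rfl⟩
  have hc : c = 0 := by simpa only [map_smul, S.η_ξ, smul_eq_mul, mul_one] using hη
  exact hu (by rw [hc, zero_smul])

end AlmostContactMetric

section Slant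

variable {E H : Type*} [NormedAddCommGroup E] [NormedSpace ℝ E] [TopologicalSpace H]
  {I : ModelWithCorners ℝ E H} {N : Type*} [TopologicalSpace N] [ChartedSpace H N]
  [IsManifold I ∞ N]

theorem SmoothMetric.angleSubspace_eq_pi_div_two (g : SmoothMetric I N) {x : N}
    {u : TangentSpace I x} {W : Submodule ℝ (TangentSpace I x)}
    (h : ∀ w ∈ W, g.inner x u w = 0) (hW : ∃ w ∈ W, w ≠ 0) :
    SmoothMetric.angleSubspace g x u W = Real.pi / 2 := by
  have hangle {w : TangentSpace I x} (hw : w ∈ W) :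
      SmoothMetric.angle g x u w = Real.pi / 2 := by
    rw [SmoothMetric.angle, h w hw, zero_div, Real.arccos_zero]
  have hset : {a : ℝ | ∃ w ∈ W, w ≠ 0 ∧ a = SmoothMetric.angle g x u w} = {Real.pi / 2} := by
    obtain ⟨w, hw, hw0⟩ := hW
    refine Set.eq_singleton_iff_unique_mem.2 ⟨⟨w, hw, hw0, (hangle hw).symm⟩, ?_⟩
    rintro _ ⟨w, hw, -, rfl⟩
    exact hangle hw
  rw [SmoothMetric.angleSubspace, hset, csInf_singleton]

theorem IsAntiInvariantSubmanifold.slant_eq_pi_div_two {E' H' : Type*} [NormedAddCommGroup E']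
    [NormedSpace ℝ E'] [TopologicalSpace H'] {I' : ModelWithCorners ℝ E' H'} {L : Type*}
    [TopologicalSpace L] [ChartedSpace H' L] {S : AlmostContactMetric I N} {j : L → N}
    {θ : L → ℝ} (hj : IsAntiInvariantSubmanifold I' S j) (hθ : IsPointwiseSlant I' S j θ)
    {p : L} {u : TangentSpace I (j p)} (hu : u ∈ tangentRange I' I j p)
    (huξ : u ∉ Submodule.span ℝ {S.ξ (j p)}) : θ p = Real.pi / 2 := by
  have hu0 : u ≠ 0 := fun h => huξ (h ▸ Submodule.zero_mem _)
  rw [← hθ p u hu huξ]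
  exact SmoothMetric.angleSubspace_eq_pi_div_two S.g (hj p u hu) ⟨u, hu, hu0⟩

end Slant

section WarpedProduct

variable {E H : Type*} [NormedAddCommGroup E] [NormedSpace ℝ E] [TopologicalSpace H]
  {I : ModelWithCorners ℝ E H} {N : Type*} [TopologicalSpace N] [ChartedSpace H N]
  {E₁ H₁ : Type*} [NormedAddCommGroup E₁] [NormedSpace ℝ E₁] [TopologicalSpace H₁]
  {I₁ : ModelWithCorners ℝ E₁ H₁} {M₁ : Type*} [TopologicalSpace M₁] [ChartedSpace H₁ M₁]
  {E₂ H₂ : Type*} [NormedAddCommGroup E₂] [NormedSpace ℝ E₂] [TopologicalSpace H₂]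
  {I₂ : ModelWithCorners ℝ E₂ H₂} {M₂ : Type*} [TopologicalSpace M₂] [ChartedSpace H₂ M₂]
  {ι : M₁ × M₂ → N} {p : M₁} {q : M₂}

theorem mfderiv_comp_prodMk_left_apply (hι : MDifferentiableAt (I₁.prod I₂) I ι (p, q))
    (u : TangentSpace I₁ p) :
    mfderiv I₁ I (fun p => ι (p, q)) p u
      = mfderiv (I₁.prod I₂) I ι (p, q) ((u, 0) : E₁ × E₂) := by
  refine .trans ?_ (mfderiv_prod_eq_add_apply hι).symm
  exact (add_eq_left.2 (map_zero (mfderiv I₂ I (fun q => ι (p, q)) q))).symm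

theorem mfderiv_comp_prodMk_right_apply (hι : MDifferentiableAt (I₁.prod I₂) I ι (p, q))
    (v : TangentSpace I₂ q) :
    mfderiv I₂ I (fun q => ι (p, q)) q v
      = mfderiv (I₁.prod I₂) I ι (p, q) ((0, v) : E₁ × E₂) := by
  refine .trans ?_ (mfderiv_prod_eq_add_apply hι).symm
  exact (add_eq_right.2 (map_zero (mfderiv I₁ I (fun p => ι (p, q)) p))).symm

theorem IsIsometricImmersion.mfderiv_injective [IsManifold I ∞ N] [IsManifold I₁ ∞ M₁]
    {gL : SmoothMetric I₁ M₁} {gN : SmoothMetric I N} {j : M₁ → N}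
    (hj : IsIsometricImmersion gL gN j) (x : M₁) : Function.Injective (mfderiv I₁ I j x) := by
  rw [injective_iff_map_eq_zero]
  intro v hv
  by_contra hne
  have hiso := hj.isometric x v v
  rw [hv, map_zero] at hiso
  exact (gL.pos x v hne).ne hiso

variable [IsManifold I₁ ∞ M₁] [IsManifold I₂ ∞ M₂] {g₁ : SmoothMetric I₁ M₁}
  {g₂ : SmoothMetric I₂ M₂} {f : M₁ → ℝ} {g : SmoothMetric (I₁.prod I₂) (M₁ × M₂)}

theorem IsWarpedProductMetric.inner_inl_inr (hg : IsWarpedProductMetric g₁ g₂ f g)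
    (x : M₁ × M₂) (u : TangentSpace I₁ x.1) (v : TangentSpace I₂ x.2) :
    g.inner x ((u, 0) : E₁ × E₂) ((0, v) : E₁ × E₂) = 0 := by
  have hfst : mfderiv (I₁.prod I₂) I₁ Prod.fst x ((0, v) : E₁ × E₂) = 0 := by
    rw [mfderiv_fst]; rfl
  have hsnd : mfderiv (I₁.prod I₂) I₂ Prod.snd x ((u, 0) : E₁ × E₂) = 0 := by
    rw [mfderiv_snd]; rfl
  refine (hg.inner_eq x ((u, 0) : E₁ × E₂) ((0, v) : E₁ × E₂)).trans ?_
  rw [hfst, hsnd, map_zero, map_zero]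
  simp

namespace IsWarpedInvariantBase

variable [IsManifold I ∞ N] {S : AlmostContactMetric I N}

theorem inner_leaf_fibre (h : IsWarpedInvariantBase S g₁ g₂ f g ι) (u : TangentSpace I₁ p)
    (v : TangentSpace I₂ q) :
    S.g.inner (ι (p, q)) (mfderiv I₁ I (fun p => ι (p, q)) p u)
      (mfderiv I₂ I (fun q => ι (p, q)) q v) = 0 := by
  have hι := h.immersion.smooth.mdifferentiable (by simp) (p, q)
  rw [mfderiv_comp_prodMk_left_apply hι, mfderiv_comp_prodMk_right_apply hι]
  exact (h.immersion.isometric _ _ _).trans (h.warped.inner_inl_inr _ u v)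

theorem η_fibre (h : IsWarpedInvariantBase S g₁ g₂ f g ι) (v : TangentSpace I₂ q) :
    S.η (ι (p, q)) (mfderiv I₂ I (fun q => ι (p, q)) q v) = 0 := by
  obtain ⟨u, hu⟩ := h.ξ_tangent p q
  rw [S.η_eq_inner_ξ, ← hu]
  exact h.inner_leaf_fibre u v

theorem mfderiv_fibre_ne_zero (h : IsWarpedInvariantBase S g₁ g₂ f g ι) {v : TangentSpace I₂ q}
    (hv : v ≠ 0) : mfderiv I₂ I (fun q => ι (p, q)) q v ≠ 0 := by
  rw [mfderiv_comp_prodMk_right_apply (h.immersion.smooth.mdifferentiable (by simp) _)]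
  exact (map_ne_zero_iff _ (h.immersion.mfderiv_injective (p, q))).2
    fun hz => hv (congrArg Prod.snd hz)

theorem isAntiInvariantSubmanifold [CompleteSpace E] [I.Boundaryless] [I₂.Boundaryless]
    (h : IsWarpedInvariantBase S g₁ g₂ f g ι) (hS : S.IsContactMetric) (p : M₁) :
    IsAntiInvariantSubmanifold I₂ S (fun q : M₂ => ι (p, q)) :=
  hS.isAntiInvariantSubmanifold
    (h.immersion.smooth.comp (contMDiff_const.prodMk contMDiff_id)) fun _ => h.η_fibre

end IsWarpedInvariantBase

end WarpedProduct

theorem theorem4_general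
    {E H : Type*} [NormedAddCommGroup E] [NormedSpace ℝ E] [CompleteSpace E] [TopologicalSpace H]
    {I : ModelWithCorners ℝ E H} [I.Boundaryless]
    {N : Type*} [TopologicalSpace N] [ChartedSpace H N] [IsManifold I ∞ N]
    {E₁ H₁ : Type*} [NormedAddCommGroup E₁] [NormedSpace ℝ E₁] [TopologicalSpace H₁]
    {I₁ : ModelWithCorners ℝ E₁ H₁}
    {MT : Type*} [TopologicalSpace MT] [ChartedSpace H₁ MT] [IsManifold I₁ ∞ MT]
    {E₂ H₂ : Type*} [NormedAddCommGroup E₂] [NormedSpace ℝ E₂] [Nontrivial E₂]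
    [TopologicalSpace H₂] {I₂ : ModelWithCorners ℝ E₂ H₂} [I₂.Boundaryless]
    {Mθ : Type*} [TopologicalSpace Mθ] [ChartedSpace H₂ Mθ] [IsManifold I₂ ∞ Mθ]
    (S : AlmostContactMetric I N) (hS : S.IsContactMetric)
    (gT : SmoothMetric I₁ MT) (gθ : SmoothMetric I₂ Mθ) (f : MT → ℝ)
    (g : SmoothMetric (I₁.prod I₂) (MT × Mθ)) (ι : MT × Mθ → N) (θ : MT × Mθ → ℝ)
    (hM : IsWarpedPointwiseSemiSlant S gT gθ f g ι θ) :
    IsContactCRWarped S gT gθ f g ι ∧ ∀ x : MT × Mθ, θ x = Real.pi / 2 := by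
  have hanti := hM.isAntiInvariantSubmanifold hS
  refine ⟨⟨hM.toIsWarpedInvariantBase, hanti⟩, fun (p, q) => ?_⟩
  obtain ⟨v, hv⟩ := exists_ne (0 : E₂)
  exact (hanti p).slant_eq_pi_div_two (hM.slant p) (LinearMap.mem_range_self _ v)
    (AlmostContactMetric.notMem_span_ξ (hM.η_fibre v) (hM.mfderiv_fibre_ne_zero hv))

theorem theorem4
    {E : Type*} [NormedAddCommGroup E] [NormedSpace ℝ E] [FiniteDimensional ℝ E]
    {N : Type*} [TopologicalSpace N] [ChartedSpace E N] [IsManifold 𝓘(ℝ, E) ∞ N]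
    {E₁ : Type*} [NormedAddCommGroup E₁] [NormedSpace ℝ E₁] [FiniteDimensional ℝ E₁]
    {MT : Type*} [TopologicalSpace MT] [ChartedSpace E₁ MT] [IsManifold 𝓘(ℝ, E₁) ∞ MT]
    {E₂ : Type*} [NormedAddCommGroup E₂] [NormedSpace ℝ E₂] [FiniteDimensional ℝ E₂]
    [Nontrivial E₂]
    {Mθ : Type*} [TopologicalSpace Mθ] [ChartedSpace E₂ Mθ] [IsManifold 𝓘(ℝ, E₂) ∞ Mθ]
    (S : AlmostContactMetric 𝓘(ℝ, E) N) (hS : S.IsSasakian)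
    (gT : SmoothMetric 𝓘(ℝ, E₁) MT) (gθ : SmoothMetric 𝓘(ℝ, E₂) Mθ) (f : MT → ℝ)
    (g : SmoothMetric (𝓘(ℝ, E₁).prod 𝓘(ℝ, E₂)) (MT × Mθ))
    (ι : MT × Mθ → N) (θ : MT × Mθ → ℝ)
    (hM : IsWarpedPointwiseSemiSlant S gT gθ f g ι θ) :
    (IsContactCRWarped S gT gθ f g ι ∧ ∀ x : MT × Mθ, θ x = Real.pi / 2) ∨
    (∀ x : MT × Mθ,
      Real.cos (θ x) ≠ 0 ∧
      MDifferentiableAt (𝓘(ℝ, E₁).prod 𝓘(ℝ, E₂)) 𝓘(ℝ, ℝ) θ x ∧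
      (∀ X : TangentSpace 𝓘(ℝ, E₁) x.1,
        mvfderiv 𝓘(ℝ, E₁) (fun p => Real.log (f p)) x.1 X
          = Real.tan (θ x) * mvfderiv 𝓘(ℝ, E₁) (fun p => θ (p, x.2)) x.1 X) ∧
      SmoothMetric.grad g (fun y => Real.log (f y.1)) x
        = Real.tan (θ x) • SmoothMetric.grad g θ x) := by
  have : CompleteSpace E := FiniteDimensional.complete ℝ E
  exact .inl (theorem4_general S hS.contact gT gθ f g ι θ hM)
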